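/- Let $\mathcal{A}$ be an AB3 abelian category (i.e. abelian and cocomplete) and let $\mathcal{B}$ be an additive subcategory of $\mathcal{A}$, that is, a full subcategory closed under isomorphisms that contains the zero object and is closed under finite coproducts. For a set $\mathcal{U}$ of objects of $\mathcal{A}$, let $\mathrm{Sum}(\mathcal{U})$ be the class of all coproducts of (set-indexed) families of objects of $\mathcal{U}$, let $\mathrm{Gen}(\mathcal{U})$ be the class of epimorphic images of objects of $\mathrm{Sum}(\mathcal{U})$, and let $\mathrm{Pres}(\mathcal{U})$ be the full subcategory of objects isomorphic to the cokernel in $\mathcal{A}$ of a morphism between objects of $\mathrm{Sum}(\mathcal{U})$. Let $\operatorname{tr}_{\mathcal{U}}(X)$ denote the largest subobject of $X$ that lies in $\mathrm{Gen}(\mathcal{U})$ (it exists and is the image of the canonical morphism $\coprod_{U\in\mathcal{U}}U^{(\mathcal{A}(U,X))}\to X$). The set $\mathcal{U}$ is called self-small if, for every family $(U_i)_{i\in I}$ of objects of $\mathcal{U}$ and every $U\in\mathcal{U}$, the canonical map $\coprod_{i\in I}\mathcal{A}(U,U_i)\to\mathcal{A}(U,\coprod_{i\in I}U_i)$ is an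 isomorphism. Consider the following conditions on a set $\mathcal{U}$ of objects of $\mathcal{A}$: (a) $\mathcal{B}=\mathrm{Pres}(\mathcal{U})$; (b) for every epimorphism $p:\tilde U\twoheadrightarrow Y$ in $\mathcal{A}$ with $\tilde U\in\mathrm{Sum}(\mathcal{U})$ and $Y$ a subobject of an object of $\mathrm{Pres}(\mathcal{U})$, and every $U\in\mathcal{U}$, the map $\mathcal{A}(U,p):\mathcal{A}(U,\tilde U)\to\mathcal{A}(U,Y)$ is surjective and $\mathcal{A}\left(U,\operatorname{Ker}p/\operatorname{tr}_{\mathcal{U}}(\operatorname{Ker}p)\right)=0$. Then the following assertions are equivalent: (1) the inclusion $\mathcal{B}\hookrightarrow\mathcal{A}$ has a right adjoint (i.e. $\mathcal{B}$ is coreflective) and $\mathcal{B}$ is equivalent to the category $\mathrm{Mod}\text{-}\mathcal{C}$ of additive functors $\mathcal{C}^{\mathrm{op}}\to\mathrm{Ab}$ for some small preadditive category $\mathcal{C}$; (2) $\mathcal{B}$ is closed under taking cokernels in $\mathcal{A}$ and there is a self-small set $\mathcal{U}$ of objects of $\mathcal{A}$ satisfying (a) and (b). Moreover, when these assertions hold,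 $\mathcal{B}$ is equivalent to the category $\mathrm{Mod}\text{-}R$ of right modules over some (associative unital) ring $R$ if and only if the set $\mathcal{U}$ in (2) may be chosen to consist of a single object. -/

import Mathlib

open CategoryTheory CategoryTheory.Limits

universe v u

namespace PresentedObjects

variable {A : Type u} [Category.{v} A]

/-- `Sum(𝒰)`: the objects that are (small) coproducts of families of objects of `𝒰`. -/
def SumOf (𝒰 : Set A) : ObjectProperty A := fun Z =>
  ∃ (I : Type v) (X : I → A) (ι : ∀ i, X i ⟶ Z),
    (∀ i, X i ∈ 𝒰) ∧ Nonempty (IsColimit (Cofan.mk Z ι))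

/-- `Gen(𝒰)`: the objects that are epimorphic images of coproducts of objects of `𝒰`. -/
def Gen (𝒰 : Set A) : ObjectProperty A := fun Y =>
  ∃ (Z : A) (p : Z ⟶ Y), SumOf 𝒰 Z ∧ Epi p

/-- `f` is a `𝒰`-epimorphism: `A(U, f)` is surjective for every `U ∈ 𝒰`. -/
def IsEpiRelTo (𝒰 : Set A) {X Y : A} (f : X ⟶ Y) : Prop :=
  ∀ U ∈ 𝒰, Function.Surjective (fun h : U ⟶ X => h ≫ f)

section Abelian

variable [Abelian A]

/-- `Pres(𝒰)`: the objects isomorphic to cokernels of morphisms in `Sum(𝒰)`. -/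
def Pres (𝒰 : Set A) : ObjectProperty A := fun Y =>
  ∃ (Z₁ Z₀ : A) (f : Z₁ ⟶ Z₀), SumOf 𝒰 Z₁ ∧ SumOf 𝒰 Z₀ ∧ Nonempty (Y ≅ cokernel f)

/-- `T` is the trace of `𝒰` in `X`: the largest `𝒰`-generated subobject of `X`. -/
def IsTrace (𝒰 : Set A) {X : A} (T : Subobject X) : Prop :=
  Gen 𝒰 (T : A) ∧ ∀ S : Subobject X, Gen 𝒰 (S : A) → S ≤ T

variable [HasColimits A]

/-- The index set of `∐_{U ∈ 𝒰} U^(A(U, X))`, realised in `Type v` since `𝒰` is a small set. -/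
abbrev TraceIndex (𝒰 : Set A) [Small.{v} 𝒰] (X : A) : Type v :=
  Σ i : Shrink.{v} 𝒰, (((equivShrink 𝒰).symm i : 𝒰) : A) ⟶ X

/-- The canonical morphism `∐_{U ∈ 𝒰} U^(A(U, X)) ⟶ X`. -/
noncomputable def canonicalMap (𝒰 : Set A) [Small.{v} 𝒰] (X : A) :
    (∐ fun i : TraceIndex 𝒰 X => (((equivShrink 𝒰).symm i.1 : 𝒰) : A)) ⟶ X :=
  Sigma.desc fun i => i.2

/-- The trace `tr_𝒰(X)` of a small set `𝒰` of objects in `X`: the image of the canonical morphism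
`∐_{U ∈ 𝒰} U^(A(U, X)) ⟶ X`. By `isTrace_trace` it is the largest `𝒰`-generated subobject. -/
noncomputable def trace (𝒰 : Set A) [Small.{v} 𝒰] (X : A) : Subobject X :=
  imageSubobject (canonicalMap 𝒰 X)

theorem factors_trace (𝒰 : Set A) [Small.{v} 𝒰] {X U : A} (hU : U ∈ 𝒰) (g : U ⟶ X) :
    (trace 𝒰 X).Factors g := by
  obtain ⟨i, hi⟩ := (equivShrink 𝒰).symm.surjective ⟨U, hU⟩
  have hU' : U = (((equivShrink 𝒰).symm i : 𝒰) : A) := by rw [hi]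
  subst hU'
  have h := imageSubobject_factors_comp_self (canonicalMap 𝒰 X)
    (Sigma.ι (fun i : TraceIndex 𝒰 X => (((equivShrink 𝒰).symm i.1 : 𝒰) : A)) ⟨i, g⟩)
  simpa [canonicalMap, trace] using h

theorem isTrace_trace (𝒰 : Set A) [Small.{v} 𝒰] (X : A) : IsTrace 𝒰 (trace 𝒰 X) := by
  refine ⟨⟨_, factorThruImageSubobject (canonicalMap 𝒰 X), ⟨TraceIndex 𝒰 X, _, _,
    fun i => ((equivShrink 𝒰).symm i.1).2, ⟨coproductIsCoproduct _⟩⟩, ?_⟩, ?_⟩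
  · have h : Epi (factorThruImageSubobject (canonicalMap 𝒰 X)) := inferInstance
    exact h
  rintro S ⟨Z, p, ⟨I, Y, ι, hY, ⟨hc⟩⟩, hp⟩
  have h : ∀ i, (trace 𝒰 X).Factors (ι i ≫ p ≫ S.arrow) := fun i => factors_trace 𝒰 (hY i) _
  let k : Z ⟶ (trace 𝒰 X : A) :=
    Cofan.IsColimit.desc hc fun i => (trace 𝒰 X).factorThru _ (h i)
  have hk : k ≫ (trace 𝒰 X).arrow = p ≫ S.arrow :=
    Cofan.IsColimit.hom_ext hc _ _ fun i => by
      have := Cofan.IsColimit.fac hc (fun i => (trace 𝒰 X).factorThru _ (h i)) i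
      simp only [Cofan.inj, Cofan.mk_ι_app] at this ⊢
      rw [reassoc_of% this]
      simp
  have sq : CommSq k p (trace 𝒰 X).arrow S.arrow := ⟨hk⟩
  have : StrongEpi p := strongEpi_of_epi p
  exact Subobject.le_of_comm sq.lift sq.fac_right

/-- The canonical map `∐ᵢ A(U, Xᵢ) → A(U, ∐ᵢ Xᵢ)` of abelian groups. -/
noncomputable def coprodHomMap (U : A) {I : Type v} (X : I → A) :
    (DirectSum I fun i => U ⟶ X i) →+ (U ⟶ ∐ X) :=
  letI := Classical.decEq I
  DirectSum.toAddMonoid fun i => Preadditive.rightComp U (Sigma.ι X i)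

/-- `𝒰` is self-small: `∐ᵢ A(U, Uᵢ) → A(U, ∐ᵢ Uᵢ)` is an isomorphism for all `U ∈ 𝒰` and all
small families `(Uᵢ)` in `𝒰`. -/
def IsSelfSmall (𝒰 : Set A) : Prop :=
  ∀ (I : Type v) (X : I → A), (∀ i, X i ∈ 𝒰) → ∀ U ∈ 𝒰, Function.Bijective (coprodHomMap U X)

/-- For every epimorphism `p : Z ⟶ Y` with `Z ∈ Sum(𝒰)` and `Y` a subobject of an object of
`Pres(𝒰)`: `p` is a `𝒰`-epimorphism, and `A(U, Ker p / tr_𝒰(Ker p)) = 0` for all `U ∈ 𝒰`. -/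
def ProjTraceCondition (𝒰 : Set A) [Small.{v} 𝒰] : Prop :=
  ∀ (Z Y P : A) (p : Z ⟶ Y) (m : Y ⟶ P), SumOf 𝒰 Z → Pres 𝒰 P → Mono m → Epi p →
    IsEpiRelTo 𝒰 p ∧
      ∀ U ∈ 𝒰, ∀ g : U ⟶ cokernel (trace 𝒰 (kernel p)).arrow, g = 0

end Abelian

/-- `Mod-C`: the category of right modules over a small preadditive category `C`, that is, of
additive functors `Cᵒᵖ ⥤ Ab`. -/
abbrev RightMod (C : Type v) [SmallCategory C] [Preadditive C] :=
  Cᵒᵖ ⥤+ AddCommGrpCat.{v}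

end PresentedObjects

open PresentedObjects

/-! The lifting half of (b) makes each `U ∈ 𝒰` behave like a projective object for presentations,
and self-smallness makes it behave like a finitely generated one. So `P ↦ A(-, P)|_𝒰` identifies
`Pres(𝒰)` with modules over the full subcategory on `𝒰`. It is faithful since `𝒰` generates, full
since a module map can be built on a presentation (`exists_hom_of_natural`), and essentially
surjective since a presentation by free modules lifts to a morphism of coproducts
(`exists_pres_addEquiv`). Covering `X` by all maps from `𝒰`, and then the kernel likewise, gives the
coreflection (`exists_pres_bijective`).

Conversely, a coreflective `B` is closed under colimits of `A`. Transport the representables into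
`B`. What is needed of them is `IsModuleLike`: they detect isomorphisms, and an element killed by
every map killing the images of all `fᵢ` lies in the sum of these images. Applied to coproduct
injections, the second property gives self-smallness; applied to one morphism, it gives lifting.
Detection of isomorphisms gives `B = Pres(𝒰)`. The trace half of (b) follows from the lifting half
(`ProjCondition.projTraceCondition`). -/

namespace PresentedObjects

/-! ### Lifting properties of presentations. -/

section Pres

variable {A : Type u} [Category.{v} A] [Abelian A] [HasColimits A]

omit [Abelian A] in
theorem sumOf_sigma {𝒰 : Set A} {I : Type v} {X : I → A} (hX : ∀ i, X i ∈ 𝒰) :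
    SumOf 𝒰 (∐ X) :=
  ⟨I, X, Sigma.ι X, hX, ⟨coproductIsCoproduct X⟩⟩

omit [HasColimits A] in
theorem pres_cokernel {𝒰 : Set A} {Z₁ Z₀ : A} (h₁ : SumOf 𝒰 Z₁) (h₀ : SumOf 𝒰 Z₀)
    (f : Z₁ ⟶ Z₀) : Pres 𝒰 (cokernel f) :=
  ⟨Z₁, Z₀, f, h₁, h₀, ⟨Iso.refl _⟩⟩

theorem pres_of_sumOf {𝒰 : Set A} {Z : A} (hZ : SumOf 𝒰 Z) : Pres 𝒰 Z :=
  ⟨∐ (fun i : PEmpty.{v + 1} => i.elim), Z, 0, sumOf_sigma fun i => i.elim, hZ,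
    ⟨cokernelZeroIsoTarget.symm⟩⟩

omit [Abelian A] in
/-- The sum of all objects of `𝒰` mapping to `X` receives all morphisms from `𝒰` to `X`. -/
theorem exists_sumOf_lift (𝒰 : Set A) [Small.{v} 𝒰] (X : A) :
    ∃ (Z : A) (t : Z ⟶ X), SumOf 𝒰 Z ∧ IsEpiRelTo 𝒰 t := by
  refine ⟨_, canonicalMap 𝒰 X, sumOf_sigma fun i => ((equivShrink 𝒰).symm i.1).2, fun U hU g => ?_⟩
  obtain ⟨i, hi⟩ := (equivShrink 𝒰).symm.surjective ⟨U, hU⟩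
  have hU' : U = (((equivShrink 𝒰).symm i : 𝒰) : A) := by rw [hi]
  subst hU'
  exact ⟨Sigma.ι (fun i : TraceIndex 𝒰 X => (((equivShrink 𝒰).symm i.1 : 𝒰) : A)) ⟨i, g⟩,
    by simp [canonicalMap]⟩

/-- Epimorphisms from sums of `𝒰` onto subobjects of presented objects are `𝒰`-epimorphisms. -/
def ProjCondition (𝒰 : Set A) : Prop :=
  ∀ (Z Y P : A) (p : Z ⟶ Y) (m : Y ⟶ P), SumOf 𝒰 Z → Pres 𝒰 P → Mono m → Epi p → IsEpiRelTo 𝒰 p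

theorem ProjTraceCondition.projCondition {𝒰 : Set A} [Small.{v} 𝒰] (h : ProjTraceCondition 𝒰) :
    ProjCondition 𝒰 :=
  fun Z Y P p m hZ hP hm hp => (h Z Y P p m hZ hP hm hp).1

omit [HasColimits A] in
theorem ProjCondition.isEpiRelTo_cokernel_π {𝒰 : Set A} (h : ProjCondition 𝒰) {Z₁ Z₀ : A}
    (h₁ : SumOf 𝒰 Z₁) (h₀ : SumOf 𝒰 Z₀) (f : Z₁ ⟶ Z₀) : IsEpiRelTo 𝒰 (cokernel.π f) :=
  h _ _ _ _ (𝟙 _) h₀ (pres_cokernel h₁ h₀ f) inferInstance inferInstance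

/-- The image of `f` is a subobject of `Z₀`, which is itself presented, so the lifting condition
applies to `Z₁ ↠ im f`. -/
theorem ProjCondition.exists_lift {𝒰 : Set A} (h : ProjCondition 𝒰) {Z₁ Z₀ : A}
    (h₁ : SumOf 𝒰 Z₁) (h₀ : SumOf 𝒰 Z₀) (f : Z₁ ⟶ Z₀) {U : A} (hU : U ∈ 𝒰) (g : U ⟶ Z₀)
    (hg : g ≫ cokernel.π f = 0) : ∃ k : U ⟶ Z₁, k ≫ f = g := by
  obtain ⟨k, hk⟩ := h _ _ _ (Abelian.factorThruImage f) (Abelian.image.ι f) h₁ (pres_of_sumOf h₀)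
    inferInstance inferInstance U hU (kernel.lift _ g hg)
  refine ⟨k, ?_⟩
  have := congrArg (· ≫ Abelian.image.ι f) hk
  simpa using this

/-- The trace part of `ProjTraceCondition` is a consequence of the lifting part. -/
theorem ProjCondition.projTraceCondition {𝒰 : Set A} [Small.{v} 𝒰] (h : ProjCondition 𝒰) :
    ProjTraceCondition 𝒰 := by
  refine fun Z Y P p m hZ hP hm hp => ⟨h Z Y P p m hZ hP hm hp, fun U hU g => ?_⟩
  let T := (trace 𝒰 (kernel p)).arrow
  obtain ⟨S, e, hS, he⟩ : Gen 𝒰 (trace 𝒰 (kernel p) : A) := (isTrace_trace 𝒰 (kernel p)).1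
  -- The image of `f` is the trace of `Ker p`, so `cokernel f` is `Z` modulo that trace: a presented
  -- object into which `Ker p / tr` embeds by `j`.
  let f := e ≫ T ≫ kernel.ι p
  have hTf : T ≫ kernel.ι p ≫ cokernel.π f = 0 := by
    rw [← cancel_epi e, comp_zero]
    exact (by simp only [f, Category.assoc] : _ = f ≫ cokernel.π f).trans (cokernel.condition f)
  let j : cokernel T ⟶ cokernel f := cokernel.desc T (kernel.ι p ≫ cokernel.π f) hTf
  have hj : Mono j := by
    refine Preadditive.mono_of_cancel_zero _ fun {G} a ha => ?_
    obtain ⟨G', d, hd, b, hb⟩ := surjective_up_to_refinements_of_epi (cokernel.π T) a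
    have hbf : b ≫ kernel.ι p ≫ cokernel.π f = 0 := by
      have : b ≫ cokernel.π T ≫ j = 0 := by rw [← reassoc_of% hb, ha, comp_zero]
      simpa [j] using this
    have hfT : f ≫ cokernel.π (T ≫ kernel.ι p) = 0 := by
      rw [Category.assoc, cokernel.condition, comp_zero]
    have hbT : (b ≫ kernel.ι p) ≫ cokernel.π (T ≫ kernel.ι p) = 0 := by
      rw [← cokernel.π_desc f (cokernel.π (T ≫ kernel.ι p)) hfT, Category.assoc,
        reassoc_of% hbf, zero_comp]
    have hb' : Abelian.monoLift (T ≫ kernel.ι p) _ hbT ≫ T = b := by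
      rw [← cancel_mono (kernel.ι p), Category.assoc, Abelian.monoLift_comp]
    rw [← cancel_epi d, hb, ← hb', Category.assoc, cokernel.condition, comp_zero, comp_zero]
  -- Lift `g ≫ j` to `k : U ⟶ Z`. Since `k` lands in `Ker p`, it lands in the trace, which dies in
  -- `cokernel f`.
  obtain ⟨k, hk⟩ := h.isEpiRelTo_cokernel_π hS hZ f U hU (g ≫ j)
  dsimp only at hk
  let r : cokernel f ⟶ Y := cokernel.desc _ p (by simp [f])
  have hjr : j ≫ r = 0 := by
    rw [← cancel_epi (cokernel.π T)]; simp [j, r]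
  have hkp : k ≫ p = 0 := by
    have : k ≫ cokernel.π f ≫ r = k ≫ p := by simp [r]
    rw [← this, reassoc_of% hk, hjr, comp_zero]
  have hk0 : k ≫ cokernel.π f = 0 := by
    have hfac := factors_trace 𝒰 hU (kernel.lift p k hkp)
    have e : k = (trace 𝒰 (kernel p)).factorThru _ hfac ≫ T ≫ kernel.ι p := by
      rw [← Category.assoc, Subobject.factorThru_arrow, kernel.lift_ι]
    rw [e, Category.assoc, Category.assoc, hTf, comp_zero]
  rw [← cancel_mono j, zero_comp, ← hk, hk0]

/-! ### Maps out of presented objects and the coreflection. -/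

omit [HasColimits A] in
theorem Pres.hom_ext {𝒰 : Set A} {P Q : A} (hP : Pres 𝒰 P) {F G : P ⟶ Q}
    (h : ∀ U ∈ 𝒰, ∀ x : U ⟶ P, x ≫ F = x ≫ G) : F = G := by
  obtain ⟨Z₁, Z₀, f, -, ⟨I, X, ι, hX, ⟨hc⟩⟩, ⟨e⟩⟩ := hP
  rw [← cancel_epi e.inv, ← cancel_epi (cokernel.π f)]
  exact Cofan.IsColimit.hom_ext hc _ _ fun i => by
    simpa [Cofan.inj] using h (X i) (hX i) (ι i ≫ cokernel.π f ≫ e.inv)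

/-- Every object admits a `𝒰`-coreflection from a presented object. -/
theorem exists_pres_bijective (𝒰 : Set A) [Small.{v} 𝒰]
    (h : ∀ ⦃Z₁ Z₀ : A⦄, SumOf 𝒰 Z₁ → SumOf 𝒰 Z₀ → ∀ f : Z₁ ⟶ Z₀, IsEpiRelTo 𝒰 (cokernel.π f))
    (X : A) : ∃ (W : A) (r : W ⟶ X), Pres 𝒰 W ∧
      ∀ U ∈ 𝒰, Function.Bijective fun g : U ⟶ W => g ≫ r := by
  -- `Z₀` supplies all maps from `𝒰` to `X`, giving surjectivity; `Z₁` supplies all relations among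
  -- them, giving injectivity.
  obtain ⟨Z₀, t, h₀, ht⟩ := exists_sumOf_lift 𝒰 X
  obtain ⟨Z₁, s, h₁, hs⟩ := exists_sumOf_lift 𝒰 (kernel t)
  refine ⟨cokernel (s ≫ kernel.ι t), cokernel.desc _ t (by simp), pres_cokernel h₁ h₀ _,
    fun U hU => ⟨?_, fun g => ?_⟩⟩
  · let c := Preadditive.rightComp U (cokernel.desc (s ≫ kernel.ι t) t (by simp))
    refine (injective_iff_map_eq_zero c).2 fun g hg => ?_
    obtain ⟨k, rfl⟩ := h h₁ h₀ (s ≫ kernel.ι t) U hU g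
    have hk : k ≫ t = 0 := by simpa [c, Preadditive.rightComp] using hg
    obtain ⟨l, hl⟩ := hs U hU (kernel.lift t k hk)
    have : k = l ≫ s ≫ kernel.ι t := by
      rw [← Category.assoc]; dsimp only at hl; rw [hl, kernel.lift_ι]
    simp only [this, Category.assoc]
    rw [← Category.assoc s, cokernel.condition, comp_zero]
  · obtain ⟨k, hk⟩ := ht U hU g
    exact ⟨k ≫ cokernel.π _, by simpa using hk⟩

-- Hom out of a colimit is a limit, so bijectivity passes from `𝒰` to sums, and then to cokernels in
-- `Pres.bijective_comp`.
omit [Abelian A] [HasColimits A] in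
theorem SumOf.bijective_comp {𝒰 : Set A} {W X Z : A} (r : W ⟶ X)
    (h : ∀ U ∈ 𝒰, Function.Bijective fun g : U ⟶ W => g ≫ r) (hZ : SumOf 𝒰 Z) :
    Function.Bijective fun g : Z ⟶ W => g ≫ r := by
  obtain ⟨I, Y, ι, hY, ⟨hc⟩⟩ := hZ
  refine ⟨fun a b hab => Cofan.IsColimit.hom_ext hc _ _ fun i => (h _ (hY i)).1 ?_, fun g => ?_⟩
  · have := congrArg (ι i ≫ ·) hab
    simpa [Cofan.inj] using this
  · choose k hk using fun i => (h _ (hY i)).2 (ι i ≫ g)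
    refine ⟨Cofan.IsColimit.desc hc k, Cofan.IsColimit.hom_ext hc _ _ fun i => ?_⟩
    have := Cofan.IsColimit.fac hc k i
    dsimp only at this ⊢
    rw [reassoc_of% this]
    exact hk i

omit [HasColimits A] in
theorem Pres.bijective_comp {𝒰 : Set A} {W X P : A} (r : W ⟶ X)
    (h : ∀ U ∈ 𝒰, Function.Bijective fun g : U ⟶ W => g ≫ r) (hP : Pres 𝒰 P) :
    Function.Bijective fun g : P ⟶ W => g ≫ r := by
  obtain ⟨Z₁, Z₀, f, h₁, h₀, ⟨e⟩⟩ := hP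
  refine ⟨fun a b hab => ?_, fun g => ?_⟩
  · rw [← cancel_epi e.inv, ← cancel_epi (cokernel.π f)]
    apply (h₀.bijective_comp r h).1
    simpa using congrArg ((cokernel.π f ≫ e.inv) ≫ ·) hab
  · obtain ⟨k, hk⟩ := (h₀.bijective_comp r h).2 (cokernel.π f ≫ e.inv ≫ g)
    dsimp only at hk
    have hfk : f ≫ k = 0 := (h₁.bijective_comp r h).1 <| by simp [hk]
    refine ⟨e.hom ≫ cokernel.desc f k hfk, ?_⟩
    dsimp only
    rw [← cancel_epi e.inv, ← cancel_epi (cokernel.π f)]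
    simpa using hk

omit [Abelian A] [HasColimits A] in
/-- If every object has a coreflection in `B`, then the inclusion of `B` has a right adjoint. -/
theorem isLeftAdjoint_ι_of_bijective (B : ObjectProperty A)
    (h : ∀ X : A, ∃ (W : A) (r : W ⟶ X), B W ∧
      ∀ P, B P → Function.Bijective fun g : P ⟶ W => g ≫ r) : B.ι.IsLeftAdjoint := by
  choose R r hR hr using h
  exact (Adjunction.adjunctionOfEquivRight (F := B.ι) (G_obj := fun X => ⟨R X, hR X⟩)
    (fun P X => ((Equiv.ofBijective _ (hr X P.obj P.property)).symm.trans
      ⟨fun g => ObjectProperty.homMk g, fun g => g.hom, fun _ => rfl, fun _ => rfl⟩))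
    (fun P' P X f g => by
      ext
      apply (hr X P'.obj P'.property).1
      have := Equiv.ofBijective_apply_symm_apply _ (hr X P'.obj P'.property)
      have h2 := Equiv.ofBijective_apply_symm_apply _ (hr X P.obj P.property)
      simp [this, h2])).isLeftAdjoint

theorem isLeftAdjoint_ι_pres {𝒰 : Set A} [Small.{v} 𝒰] (h : ProjCondition 𝒰) :
    (Pres 𝒰).ι.IsLeftAdjoint :=
  isLeftAdjoint_ι_of_bijective _ fun X => by
    obtain ⟨W, r, hW, hr⟩ := exists_pres_bijective 𝒰 (fun _ _ => h.isEpiRelTo_cokernel_π) X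
    exact ⟨W, r, hW, fun P hP => hP.bijective_comp r hr⟩

/-! ### Presented objects as modules. -/

theorem coprodHomMap_of {I : Type v} [dec : DecidableEq I] (U : A) (X : I → A) (i : I)
    (x : U ⟶ X i) :
    coprodHomMap U X (DirectSum.of (fun i => U ⟶ X i) i x) = x ≫ Sigma.ι X i := by
  obtain rfl : dec = Classical.decEq I := Subsingleton.elim _ _
  let := Classical.decEq I
  exact DirectSum.toAddMonoid_of _ _ _

/-- Surjectivity in self-smallness, in usable form: a map from `U` to a coproduct is a finite sum of
maps through injections, so additive identities need checking only on those. -/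
theorem IsSelfSmall.induction {𝒰 : Set A} (hs : IsSelfSmall 𝒰) {I : Type v} {X : I → A} {Z : A}
    {ι : ∀ i, X i ⟶ Z} (hX : ∀ i, X i ∈ 𝒰) (hc : IsColimit (Cofan.mk Z ι)) {U : A} (hU : U ∈ 𝒰)
    {p : (U ⟶ Z) → Prop} (zero : p 0) (add : ∀ a b, p a → p b → p (a + b))
    (of : ∀ i (h : U ⟶ X i), p (h ≫ ι i)) (g : U ⟶ Z) : p g := by
  classical
  let e : ∐ X ⟶ Z := Sigma.desc ι
  let e' : Z ⟶ ∐ X := Cofan.IsColimit.desc hc (Sigma.ι X)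
  have he : e' ≫ e = 𝟙 Z := Cofan.IsColimit.hom_ext hc _ _ fun i => by
    have := Cofan.IsColimit.fac hc (Sigma.ι X) i
    rw [reassoc_of% this]
    simp [e, Cofan.inj]
  obtain ⟨d, hd⟩ := (hs I X hX U hU).2 (g ≫ e')
  have : g = coprodHomMap U X d ≫ e := by rw [hd, Category.assoc, he, Category.comp_id]
  rw [this]
  clear this hd
  induction d using DirectSum.induction_on with
  | zero => simpa using zero
  | of i x =>
    simpa [coprodHomMap_of, e] using of i x
  | add a b ha hb => simpa [Preadditive.add_comp] using add _ _ ha hb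

/-- Compatible additive maps `A(Uⱼ, P) → A(Uⱼ, Q)` are induced by a morphism `P ⟶ Q`. -/
theorem exists_hom_of_natural {J : Type v} {u : J → A} {𝒰 : Set A} (hu : 𝒰 = Set.range u)
    (hs : IsSelfSmall 𝒰) (hp : ProjCondition 𝒰) {P Q : A} (hP : Pres 𝒰 P)
    (φ : ∀ j, (u j ⟶ P) →+ (u j ⟶ Q))
    (nat : ∀ (i j : J) (a : u i ⟶ u j) (x : u j ⟶ P), φ i (a ≫ x) = a ≫ φ j x) :
    ∃ F : P ⟶ Q, ∀ j x, x ≫ F = φ j x := by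
  subst hu
  obtain ⟨Z₁, Z₀, f, h₁, h₀, ⟨e⟩⟩ := hP
  have hepi := hp.isEpiRelTo_cokernel_π h₁ h₀ f
  obtain ⟨I₀, X₀, ι₀, hX₀, ⟨hc₀⟩⟩ := h₀
  obtain ⟨I₁, X₁, ι₁, hX₁, ⟨hc₁⟩⟩ := h₁
  choose s₀ hs₀ using hX₀
  choose s₁ hs₁ using hX₁
  obtain rfl : (fun i => u (s₀ i)) = X₀ := funext hs₀
  obtain rfl : (fun i => u (s₁ i)) = X₁ := funext hs₁
  let π : Z₀ ⟶ P := cokernel.π f ≫ e.inv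
  -- The only possible choice on each summand. Self-smallness and naturality extend the formula to
  -- all maps into `Z₀`, which forces `f ≫ F₀ = 0`.
  let F₀ : Z₀ ⟶ Q := Cofan.IsColimit.desc hc₀ fun i => φ (s₀ i) (ι₀ i ≫ π)
  have hF₀ι (i) : ι₀ i ≫ F₀ = φ (s₀ i) (ι₀ i ≫ π) :=
    Cofan.IsColimit.fac hc₀ (fun i => φ (s₀ i) (ι₀ i ≫ π)) i
  have hF₀ (j) (x : u j ⟶ Z₀) : x ≫ F₀ = φ j (x ≫ π) := by
    refine hs.induction (U := u j) (fun i => ⟨s₀ i, rfl⟩) hc₀ ⟨j, rfl⟩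
      (p := fun x => x ≫ F₀ = φ j (x ≫ π)) ?_ (fun a b ha hb => ?_) (fun i h => ?_) x
    · simp
    · simp [Preadditive.add_comp, ha, hb]
    · rw [Category.assoc, Category.assoc, hF₀ι, nat]
  have hfF : f ≫ F₀ = 0 := Cofan.IsColimit.hom_ext hc₁ _ _ fun i => by
    have := hF₀ (s₁ i) (ι₁ i ≫ f)
    simpa [Cofan.inj, π] using this
  refine ⟨e.hom ≫ cokernel.desc f F₀ hfF, fun j x => ?_⟩
  obtain ⟨y, hy⟩ := hepi (u j) ⟨j, rfl⟩ (x ≫ e.hom)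
  obtain rfl : y ≫ π = x := by
    rw [← cancel_mono e.hom, ← hy]; simp [π]
  rw [← hF₀]
  simp [π]

/-- Every right module over the objects `Uⱼ` is of the form `A(-, P)` with `P` presented. -/
theorem exists_pres_addEquiv {J : Type v} {u : J → A} {𝒰 : Set A} (hu : 𝒰 = Set.range u)
    (hs : IsSelfSmall 𝒰) (hp : ProjCondition 𝒰) (M : J → Type v) [∀ j, AddCommGroup (M j)]
    (act : ∀ {i j : J}, (u i ⟶ u j) →+ M j →+ M i)
    (act_id : ∀ j (m : M j), act (𝟙 (u j)) m = m)
    (act_comp : ∀ {i j k : J} (a : u i ⟶ u j) (b : u j ⟶ u k) (m : M k),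
      act (a ≫ b) m = act a (act b m)) :
    ∃ P, Pres 𝒰 P ∧ ∃ e : ∀ j, (u j ⟶ P) ≃+ M j,
      ∀ (i j : J) (a : u i ⟶ u j) (x : u j ⟶ P), e i (a ≫ x) = act a (e j x) := by
  classical
  subst hu
  -- One summand per element of `M`: the free cover, with `ψ` sending the injection at `m` to `m`.
  let X₀ : (Σ j, M j) → A := fun s => u s.1
  let Z₀ := ∐ X₀
  have hX₀ (i) : X₀ i ∈ Set.range u := ⟨i.1, rfl⟩
  let E (j) : (DirectSum _ fun i => u j ⟶ X₀ i) ≃+ (u j ⟶ Z₀) :=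
    AddEquiv.ofBijective (coprodHomMap (u j) X₀) (hs _ X₀ hX₀ _ ⟨j, rfl⟩)
  let ψ (j) : (u j ⟶ Z₀) →+ M j :=
    (DirectSum.toAddMonoid fun i => (act (i := j) (j := i.1)).flip i.2).comp
      (E j).symm.toAddMonoidHom
  have hψι (j) (s) (a : u j ⟶ X₀ s) : ψ j (a ≫ Sigma.ι X₀ s) = act a s.2 := by
    have : a ≫ Sigma.ι X₀ s = E j (DirectSum.of (fun i => u j ⟶ X₀ i) s a) := by
      exact (coprodHomMap_of _ _ s a).symm
    rw [this]
    simp [ψ]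
  have hind {j} {p : (u j ⟶ Z₀) → Prop} := hs.induction (U := u j) hX₀ (coproductIsCoproduct X₀)
    ⟨j, rfl⟩ (p := p)
  have hψ (i j) (a : u i ⟶ u j) (x : u j ⟶ Z₀) : ψ i (a ≫ x) = act a (ψ j x) := by
    refine hind (p := fun x => ψ i (a ≫ x) = act a (ψ j x)) ?_ (fun b c hb hc => ?_)
      (fun s b => ?_) x
    · simp
    · simp [hb, hc]
    · rw [← Category.assoc, hψι, hψι, act_comp]
  have hψsurj (j) : Function.Surjective (ψ j) := fun m => by
    refine ⟨𝟙 (u j) ≫ Sigma.ι X₀ ⟨j, m⟩, ?_⟩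
    exact (hψι j ⟨j, m⟩ (𝟙 _)).trans (act_id j m)
  -- One summand per relation.
  let X₁ : (Σ j, (ψ j).ker) → A := fun s => u s.1
  have hX₁ (i) : X₁ i ∈ Set.range u := ⟨i.1, rfl⟩
  let f : ∐ X₁ ⟶ Z₀ := Sigma.desc fun s => s.2.1
  have h₁ := sumOf_sigma hX₁
  have h₀ := sumOf_sigma hX₀
  -- No further relations arise: a map killed by `cokernel.π f` lifts through `f`. Hence `A(u j,
  -- cokernel f)` and `M j` are quotients of `A(u j, Z₀)` by the same subgroup.
  have hker (j) (x : u j ⟶ Z₀) : x ≫ cokernel.π f = 0 ↔ ψ j x = 0 := by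
    constructor
    · intro hx
      obtain ⟨k, rfl⟩ := hp.exists_lift h₁ h₀ f ⟨j, rfl⟩ x hx
      refine hs.induction (U := u j) hX₁ (coproductIsCoproduct X₁) ⟨j, rfl⟩
        (p := fun k => ψ j (k ≫ f) = 0) ?_ (fun a b ha hb => ?_) (fun s a => ?_) k
      · simp
      · simp [Preadditive.add_comp, ha, hb]
      · have : (a ≫ Sigma.ι X₁ s) ≫ f = a ≫ s.2.1 := by simp [f]
        rw [this, hψ, s.2.2, map_zero]
    · intro hx
      have : x = Sigma.ι X₁ ⟨j, x, hx⟩ ≫ f := by simp [f]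
      rw [this, Category.assoc, cokernel.condition, comp_zero]
  let π (j) : (u j ⟶ Z₀) →+ (u j ⟶ cokernel f) := Preadditive.rightComp _ (cokernel.π f)
  have hπ (j) : Function.Surjective (π j) := hp.isEpiRelTo_cokernel_π h₁ h₀ f _ ⟨j, rfl⟩
  have hkk (j) : (π j).ker = (ψ j).ker := AddSubgroup.ext fun x => hker j x
  let e (j) : (u j ⟶ cokernel f) ≃+ M j :=
    (QuotientAddGroup.quotientKerEquivOfSurjective (π j) (hπ j)).symm.trans
      ((QuotientAddGroup.quotientAddEquivOfEq (hkk j)).trans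
        (QuotientAddGroup.quotientKerEquivOfSurjective (ψ j) (hψsurj j)))
  have he (j) (x : u j ⟶ Z₀) : e j (x ≫ cokernel.π f) = ψ j x := by
    have : (QuotientAddGroup.quotientKerEquivOfSurjective (π j) (hπ j)).symm
        (x ≫ cokernel.π f) = QuotientAddGroup.mk x := by
      rw [AddEquiv.symm_apply_eq]; rfl
    simp only [e, AddEquiv.trans_apply, this]
    rfl
  refine ⟨_, pres_cokernel h₁ h₀ f, e, fun i j a x => ?_⟩
  obtain ⟨y, rfl⟩ := hπ j x
  have : a ≫ π j y = (a ≫ y) ≫ cokernel.π f := (Category.assoc _ _ _).symm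
  rw [this, he, hψ]
  exact congrArg _ (he j y).symm

/-- The restricted Yoneda functor `P ↦ A(-, P)` with values in right modules over the full
subcategory on the objects `Uⱼ`. -/
def restrictedYoneda {J : Type v} (u : J → A) (B : ObjectProperty A) :
    B.FullSubcategory ⥤ RightMod (InducedCategory A u) where
  obj P := ⟨(inducedFunctor u).op ⋙ preadditiveYoneda.obj P.obj, by
    rw [additiveFunctor_iff]; infer_instance⟩
  map f := ObjectProperty.homMk (Functor.whiskerLeft _ (preadditiveYoneda.map f.hom))

theorem isEquivalence_restrictedYoneda {J : Type v} {u : J → A} {𝒰 : Set A} (hu : 𝒰 = Set.range u)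
    (hs : IsSelfSmall 𝒰) (hp : ProjCondition 𝒰) :
    (restrictedYoneda u (Pres 𝒰)).IsEquivalence where
  faithful := ⟨fun {P Q} f g hfg => by
    ext
    refine P.property.hom_ext fun U hU x => ?_
    obtain ⟨j, rfl⟩ := hu ▸ hU
    have := congrArg (fun t => t.hom.app (Opposite.op j)) hfg
    exact ConcreteCategory.congr_hom this x⟩
  full := ⟨fun {P Q} t => by
    obtain ⟨F, hF⟩ := exists_hom_of_natural hu hs hp P.property (Q := Q.obj)
      (fun j => (t.hom.app (Opposite.op j)).hom) (fun i j a x =>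
        ConcreteCategory.congr_hom (t.hom.naturality (InducedCategory.homMk a).op) x)
    refine ⟨ObjectProperty.homMk F, ?_⟩
    ext j x
    exact hF _ x⟩
  essSurj := ⟨fun M => by
    obtain ⟨P, hP, e, he⟩ := exists_pres_addEquiv hu hs hp
      (fun j : J => M.obj.obj (Opposite.op (show InducedCategory A u from j)))
      (fun {i j} => AddMonoidHom.mk'
        (fun a => (M.obj.map (InducedCategory.homMk (F := u) (X := i) (Y := j) a).op).hom)
        fun a b => congrArg AddCommGrpCat.Hom.hom (M.obj.map_add
          (f := (InducedCategory.homMk (F := u) (X := i) (Y := j) a).op)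
          (g := (InducedCategory.homMk (F := u) (X := i) (Y := j) b).op)))
      (fun j m => ConcreteCategory.congr_hom (M.obj.map_id _) m)
      (fun a b m => ConcreteCategory.congr_hom (M.obj.map_comp (InducedCategory.homMk b).op
        (InducedCategory.homMk a).op) m)
    refine ⟨⟨P, hP⟩, ⟨(additiveFunctor _ _).isoMk (NatIso.ofComponents
      (fun j => AddEquiv.toAddCommGrpIso (e j.unop)) fun {i j} a => ?_)⟩⟩
    ext x
    exact he _ _ a.unop.hom x⟩

/-- The one-object case: compatibility with `End U` is exactly linearity over `(End U)ᵐᵒᵖ`. -/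
theorem isEquivalence_preadditiveCoyonedaObj {U : A} (hs : IsSelfSmall {U})
    (hp : ProjCondition {U}) :
    ((Pres {U}).ι ⋙ preadditiveCoyonedaObj U).IsEquivalence where
  faithful := ⟨fun {P Q} f g hfg => by
    ext
    refine P.property.hom_ext fun V hV x => ?_
    obtain rfl := hV
    exact ConcreteCategory.congr_hom hfg x⟩
  full := ⟨fun {P Q} t => by
    obtain ⟨F, hF⟩ := exists_hom_of_natural (J := PUnit) (u := fun _ => U)
      Set.range_const.symm hs hp P.property (Q := Q.obj)
      (fun j => t.hom.toAddMonoidHom) (fun i j a x => t.hom.map_smul (MulOpposite.op a) x)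
    refine ⟨ObjectProperty.homMk F, ?_⟩
    ext x
    exact hF ⟨⟩ x⟩
  essSurj := ⟨fun M => by
    obtain ⟨P, hP, e, he⟩ := exists_pres_addEquiv (J := PUnit) (u := fun _ => U)
      Set.range_const.symm hs hp (fun _ => M)
      (fun {_ _} => AddMonoidHom.mk'
        (fun a => DistribSMul.toAddMonoidHom M (MulOpposite.op a : (End U)ᵐᵒᵖ))
        fun a b => AddMonoidHom.ext
          (add_smul (MulOpposite.op a : (End U)ᵐᵒᵖ) (MulOpposite.op b : (End U)ᵐᵒᵖ)))
      (fun _ m => one_smul (End U)ᵐᵒᵖ m)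
      (fun a b m => mul_smul (MulOpposite.op a : (End U)ᵐᵒᵖ) (MulOpposite.op b : (End U)ᵐᵒᵖ) m)
    refine ⟨⟨P, hP⟩, ⟨LinearEquiv.toModuleIso
      { e ⟨⟩ with map_smul' := fun r x => he ⟨⟩ ⟨⟩ r.unop x }⟩⟩⟩

end Pres

/-! ### Coreflective subcategories and module-like families. -/

section Coreflective

variable {A : Type u} [Category.{v} A]

/-- A coreflective isomorphism-closed full subcategory is closed under colimits. -/
theorem isClosedUnderColimitsOfShape_of_isLeftAdjoint_ι (B : ObjectProperty A)
    [B.IsClosedUnderIsomorphisms] [B.ι.IsLeftAdjoint] (K : Type*) [Category* K] :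
    B.IsClosedUnderColimitsOfShape K where
  colimitsOfShape_le := by
    rintro X ⟨c, hc⟩
    let adj := Adjunction.ofIsLeftAdjoint B.ι
    let W := (B.ι.rightAdjoint).obj X
    let r : W.obj ⟶ X := adj.counit.app X
    let l {P : A} (hP : B P) (g : P ⟶ X) : P ⟶ W.obj := (adj.homEquiv ⟨P, hP⟩ X g).hom
    have hl {P : A} (hP : B P) (g : P ⟶ X) : l hP g ≫ r = g :=
      (adj.homEquiv ⟨P, hP⟩ X).symm_apply_apply g
    have hr {P : A} (hP : B P) {a b : P ⟶ W.obj} (h : a ≫ r = b ≫ r) : a = b := by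
      have : (ObjectProperty.homMk a : (⟨P, hP⟩ : B.FullSubcategory) ⟶ W) =
          ObjectProperty.homMk b := (adj.homEquiv ⟨P, hP⟩ X).symm.injective h
      exact congrArg (fun t => t.hom) this
    -- Lifting the cocone to the coreflection `W` yields a section of the counit `r`; as `r` is
    -- cancellable against maps from `B`, it is an isomorphism.
    let s : X ⟶ W.obj := c.isColimit.desc ⟨W.obj,
      { app := fun k => l (hc k) (c.ι.app k)
        naturality := fun k k' f => hr (hc k) (by simp [hl]) }⟩
    have hs : s ≫ r = 𝟙 X := c.isColimit.hom_ext fun k => by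
      rw [c.isColimit.fac_assoc]
      simp [hl]
    exact B.prop_of_iso ⟨r, s, hr W.property (by simp [hs]), hs⟩ W.property

theorem Pres.of_iso [Abelian A] {𝒰 : Set A} {P Q : A} (hP : Pres 𝒰 P) (e : Q ≅ P) :
    Pres 𝒰 Q := by
  obtain ⟨Z₁, Z₀, f, h₁, h₀, ⟨i⟩⟩ := hP
  exact ⟨Z₁, Z₀, f, h₁, h₀, ⟨e ≪≫ i⟩⟩

/-- A family of objects of a preadditive category that behaves like the representables in a
module category: it detects isomorphisms, and a morphism `g` from one of its members which is
killed by every morphism that kills all `fᵢ` is a finite sum of morphisms factoring through some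
`fᵢ`. -/
structure IsModuleLike {D : Type*} [Category.{v} D] [Preadditive D] {J : Type v} (y : J → D) :
    Prop where
  isIso : ∀ {X Y : D} (f : X ⟶ Y),
    (∀ j, Function.Bijective fun g : y j ⟶ X => g ≫ f) → IsIso f
  mem_iSup : ∀ {I : Type v} {F : I → D} {G : D} (f : ∀ i, F i ⟶ G) (j : J) (g : y j ⟶ G),
    (∀ (Q : D) (q : G ⟶ Q), (∀ i, f i ≫ q = 0) → g ≫ q = 0) →
      g ∈ ⨆ i, (Preadditive.rightComp (y j) (f i)).range

/-- `IsModuleLike` is invariant under additive equivalences. -/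
theorem IsModuleLike.of_equivalence {D M : Type*} [Category.{v} D] [Category.{v} M]
    [Preadditive D] [Preadditive M] {J : Type v} {y : J → M} (h : IsModuleLike y) (E : D ≌ M)
    [E.functor.Additive] : IsModuleLike fun j => E.inverse.obj (y j) where
  isIso {X Y} f hf := by
    have : IsIso (E.functor.map f) := h.isIso _ fun j => by
      let e (Z) := E.symm.toAdjunction.homEquiv (y j) Z
      have : (fun g : y j ⟶ E.functor.obj X => g ≫ E.functor.map f) =
          e Y ∘ (fun g => g ≫ f) ∘ (e X).symm := by
        ext g
        exact ((E.symm.toAdjunction.homEquiv_naturality_right _ _).trans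
          (congrArg (· ≫ _) ((e X).apply_symm_apply g))).symm
      rw [this]
      exact (e Y).bijective.comp ((hf j).comp (e X).symm.bijective)
    exact isIso_of_reflects_iso f E.functor
  mem_iSup {I F G} f j g hg := by
    have : E.symm.functor.Additive := inferInstanceAs E.inverse.Additive
    let e (Z) := E.symm.toAdjunction.homAddEquiv (y j) Z
    have he {Z Z'} (a : E.inverse.obj (y j) ⟶ Z) (b : Z ⟶ Z') :
        e Z' (a ≫ b) = e Z a ≫ E.functor.map b :=
      E.symm.toAdjunction.homEquiv_naturality_right _ _
    have key := h.mem_iSup (fun i => E.functor.map (f i)) j (e G g) fun Q q hq => by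
      obtain ⟨q', hq'⟩ : ∃ q' : G ⟶ E.inverse.obj Q, E.functor.map q' ≫ E.counit.app Q = q :=
        ⟨E.unit.app G ≫ E.inverse.map q, by simp⟩
      have : g ≫ q' = 0 := hg _ q' fun i => E.functor.map_injective <| by
        rw [← cancel_mono (E.counit.app Q)]
        simp [hq', hq]
      rw [← hq', ← Category.assoc, ← he, this, map_zero, zero_comp]
    have : (e G).symm (e G g) ∈ (⨆ i, (Preadditive.rightComp (y j)
        (E.functor.map (f i))).range).map (e G).symm.toAddMonoidHom := ⟨_, key, rfl⟩
    rw [AddEquiv.symm_apply_apply, AddSubgroup.map_iSup] at this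
    refine SetLike.le_def.1 (iSup_mono fun i => ?_) this
    rintro _ ⟨_, ⟨k, rfl⟩, rfl⟩
    refine ⟨(e (F i)).symm k, (e G).injective ?_⟩
    exact (he _ _).trans (by simp [Preadditive.rightComp])

variable [Abelian A] [HasColimits A]

/-- The projections `π i` recover the components, so self-smallness is only a matter of
surjectivity. -/
theorem coprodHomMap_injective (U : A) {I : Type v} (X : I → A) :
    Function.Injective (coprodHomMap U X) := by
  classical
  let π (i) : ∐ X ⟶ X i := Sigma.desc fun k => if h : k = i then eqToHom (congrArg X h) else 0
  have key (d) (i) : coprodHomMap U X d ≫ π i = d i := by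
    induction d using DirectSum.induction_on with
    | zero => simp
    | of k x =>
      rw [coprodHomMap_of, Category.assoc, Sigma.ι_desc]
      by_cases h : k = i
      · subst h; simp
      · simp [h, DirectSum.of_eq_of_ne _ _ _ (Ne.symm h)]
    | add a b ha hb => simp [Preadditive.add_comp, ha, hb]
  intro d d' h
  ext i
  rw [← key d i, ← key d' i, h]

theorem exists_of_isModuleLike (B : ObjectProperty A) [B.IsClosedUnderIsomorphisms]
    [B.ι.IsLeftAdjoint] {J : Type v} {y : J → B.FullSubcategory} (hy : IsModuleLike y)
    (𝒰 : Set A) [Small.{v} 𝒰] (h𝒰 : 𝒰 = Set.range fun j => (y j).obj) :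
    IsSelfSmall 𝒰 ∧ B = Pres 𝒰 ∧ ProjTraceCondition 𝒰 := by
  subst h𝒰
  set 𝒰 := Set.range fun j => (y j).obj
  have hcol (K : Type v) [SmallCategory K] : B.IsClosedUnderColimitsOfShape K :=
    isClosedUnderColimitsOfShape_of_isLeftAdjoint_ι B K
  have hcok : B.IsClosedUnderColimitsOfShape WalkingParallelPair :=
    isClosedUnderColimitsOfShape_of_isLeftAdjoint_ι B _
  have h𝒰B {U} (hU : U ∈ 𝒰) : B U := by
    obtain ⟨j, rfl⟩ := hU
    exact (y j).property
  have hsum {Z} (hZ : SumOf 𝒰 Z) : B Z := by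
    obtain ⟨I, X, ι, hX, ⟨hc⟩⟩ := hZ
    exact B.prop_of_isColimit hc fun i => h𝒰B (hX i.as)
  have hpres {P} (hP : Pres 𝒰 P) : B P := by
    obtain ⟨Z₁, Z₀, f, h₁, h₀, ⟨e⟩⟩ := hP
    refine B.prop_of_iso e.symm (B.prop_of_isColimit (colimit.isColimit (parallelPair f 0)) ?_)
    rintro (_ | _)
    · exact hsum h₁
    · exact hsum h₀
  -- `mem_iSup` read in `A`; the test objects `Q` range only over `B`.
  have hmem {I : Type v} {F : I → A} {G : A} (f : ∀ i, F i ⟶ G) (hF : ∀ i, B (F i)) (hG : B G)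
      (j : J) (g : (y j).obj ⟶ G)
      (hg : ∀ (Q : A) (q : G ⟶ Q), B Q → (∀ i, f i ≫ q = 0) → g ≫ q = 0) :
      g ∈ ⨆ i, (Preadditive.rightComp (y j).obj (f i)).range := by
    have h1 := hy.mem_iSup (F := fun i => ⟨F i, hF i⟩) (G := ⟨G, hG⟩)
      (fun i => ObjectProperty.homMk (f i)) j (ObjectProperty.homMk g) fun Q q hq => by
        ext
        exact hg _ q.hom Q.property fun i => congrArg (fun t => t.hom) (hq i)
    let θ : (y j ⟶ ⟨G, hG⟩) →+ ((y j).obj ⟶ G) := AddMonoidHom.mk' (fun t => t.hom) fun _ _ => rfl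
    have h2 := AddSubgroup.mem_map_of_mem θ h1
    rw [AddSubgroup.map_iSup] at h2
    refine SetLike.le_def.1 (iSup_mono fun i => ?_) h2
    rintro _ ⟨_, ⟨k, rfl⟩, rfl⟩
    exact ⟨k.hom, rfl⟩
  have hproj : ProjCondition 𝒰 := by
    rintro Z Y P p m hZ hP hm hp _ ⟨j, rfl⟩ g
    -- A map killing `p ≫ m` kills `m`, hence `g ≫ m`; so `g ≫ m` factors through `p ≫ m`, and the
    -- mono `m` cancels.
    have := hmem (I := PUnit) (fun _ => p ≫ m) (fun _ => hsum hZ) (hpres hP) j (g ≫ m)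
      fun Q q _ hq => by
        have : m ≫ q = 0 := by
          rw [← cancel_epi p, comp_zero]
          simpa using hq ⟨⟩
        rw [Category.assoc, this, comp_zero]
    rw [iSup_const] at this
    obtain ⟨k, hk⟩ := this
    refine ⟨k, ?_⟩
    rw [← cancel_mono m]
    simpa [Preadditive.rightComp] using hk
  refine ⟨?_, le_antisymm (fun X hX => ?_) (fun X => hpres), hproj.projTraceCondition⟩
  · classical
    rintro I X hX _ ⟨j, rfl⟩
    refine ⟨coprodHomMap_injective _ _, fun g => ?_⟩
    -- Only zero kills all injections, so every `g` is a finite sum of maps through them.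
    have := hmem (Sigma.ι X) (fun i => h𝒰B (hX i)) (hsum (sumOf_sigma hX)) j g fun Q q _ hq => by
      have : q = 0 := Sigma.hom_ext _ _ fun i => by simpa using hq i
      rw [this, comp_zero]
    refine (iSup_le (fun i => ?_) : _ ≤ (coprodHomMap (y j).obj X).range) this
    rintro _ ⟨k, rfl⟩
    exact ⟨_, coprodHomMap_of _ X i k⟩
  -- The presented coreflection of `X ∈ B` lies in `B` and is bijective on maps from `𝒰`, hence is
  -- an isomorphism.
  · obtain ⟨W, r, hW, hr⟩ := exists_pres_bijective 𝒰 (fun _ _ => hproj.isEpiRelTo_cokernel_π) X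
    have : IsIso (ObjectProperty.homMk r : (⟨W, hpres hW⟩ : B.FullSubcategory) ⟶ ⟨X, hX⟩) :=
      hy.isIso _ fun j => by
        have h := hr _ ⟨j, rfl⟩
        refine ⟨fun a b hab => ?_, fun g => ?_⟩
        · ext
          exact h.1 (congrArg (fun t => t.hom) hab)
        · obtain ⟨k, hk⟩ := h.2 g.hom
          exact ⟨ObjectProperty.homMk k, by ext; exact hk⟩
    exact hW.of_iso (B.ι.mapIso (asIso (ObjectProperty.homMk r :
      (⟨W, hpres hW⟩ : B.FullSubcategory) ⟶ ⟨X, hX⟩))).symm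

end Coreflective

/-! ### Representables and the regular module are module-like. -/

section RightMod

variable {C : Type v} [SmallCategory C] [Preadditive C]

/-- The representable right module. -/
def representable (c : C) : RightMod C :=
  ⟨preadditiveYoneda.obj c, by rw [additiveFunctor_iff]; infer_instance⟩

/-- The element of `G(c)` corresponding to a morphism from a representable. -/
def evalOne {c : C} {G : RightMod C} : (representable c ⟶ G) →+ G.obj.obj (Opposite.op c) :=
  AddMonoidHom.mk' (fun t => t.hom.app (Opposite.op c) (𝟙 c)) fun _ _ => rfl

/-- The morphism from a representable corresponding to an element of `G(c)`. -/
def ofElement {c : C} {G : RightMod C} : G.obj.obj (Opposite.op c) →+ (representable c ⟶ G) :=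
  AddMonoidHom.mk' (fun x => ObjectProperty.homMk
    { app := fun d => AddCommGrpCat.ofHom (AddMonoidHom.mk' (fun a => G.obj.map a.op x) fun a b =>
        ConcreteCategory.congr_hom (G.obj.map_add (f := a.op) (g := b.op)) x)
      naturality := fun d d' a => by
        ext b
        exact ConcreteCategory.congr_hom (G.obj.map_comp b.op a) x }) fun x y => by
    ext d a
    exact map_add (G.obj.map a.op).hom x y

theorem evalOne_ofElement {c : C} {G : RightMod C} (x : G.obj.obj (Opposite.op c)) :
    evalOne (ofElement x) = x :=
  ConcreteCategory.congr_hom (G.obj.map_id (Opposite.op c)) x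

theorem ofElement_evalOne {c : C} {G : RightMod C} (t : representable c ⟶ G) :
    ofElement (evalOne t) = t := by
  ext d a
  have := ConcreteCategory.congr_hom (t.hom.naturality a.op) (𝟙 c)
  exact this.symm.trans (congrArg (t.hom.app d) (Category.comp_id a))

theorem ofElement_comp {c : C} {F G : RightMod C} (f : F ⟶ G) (x : F.obj.obj (Opposite.op c)) :
    ofElement x ≫ f = ofElement (f.hom.app _ x) := by
  rw [← ofElement_evalOne (ofElement x ≫ f)]
  exact congrArg (fun z => ofElement (f.hom.app _ z)) (evalOne_ofElement x)

/-- The quotient of a right module by a submodule. -/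
def quotientModule (G : RightMod C) (S : ∀ d, AddSubgroup (G.obj.obj d))
    (hS : ∀ {d d'} (a : d ⟶ d'), S d ≤ (S d').comap (G.obj.map a).hom) : RightMod C :=
  ⟨{  obj d := AddCommGrpCat.of (G.obj.obj d ⧸ S d)
      map a := AddCommGrpCat.ofHom (QuotientAddGroup.map _ _ (G.obj.map a).hom (hS a))
      map_id d := by
        ext x
        exact congrArg QuotientAddGroup.mk (ConcreteCategory.congr_hom (G.obj.map_id d) x)
      map_comp a b := by
        ext x
        exact congrArg QuotientAddGroup.mk (ConcreteCategory.congr_hom (G.obj.map_comp a b) x) },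
    ⟨fun {_ _ a b} => by
      ext x
      exact congrArg QuotientAddGroup.mk
        (ConcreteCategory.congr_hom (G.obj.map_add (f := a) (g := b)) x)⟩⟩

/-- The projection to the quotient module. -/
def quotientModuleπ (G : RightMod C) (S : ∀ d, AddSubgroup (G.obj.obj d))
    (hS : ∀ {d d'} (a : d ⟶ d'), S d ≤ (S d').comap (G.obj.map a).hom) :
    G ⟶ quotientModule G S hS :=
  ObjectProperty.homMk { app := fun d => AddCommGrpCat.ofHom (QuotientAddGroup.mk' (S d)) }

theorem isModuleLike_representable : IsModuleLike (representable (C := C)) where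
  isIso {X Y} f hf := by
    have hbij (c : C) : Function.Bijective (f.hom.app (Opposite.op c)) := by
      refine ⟨fun x y hxy => ?_, fun y => ?_⟩
      · have : ofElement x = ofElement y := (hf c).1 <| by
          dsimp only
          rw [ofElement_comp, ofElement_comp, hxy]
        rw [← evalOne_ofElement x, this, evalOne_ofElement]
      · obtain ⟨t, ht⟩ := (hf c).2 (ofElement y)
        refine ⟨evalOne t, ?_⟩
        rw [← evalOne_ofElement y, ← ht]
        rfl
    have happ (d) : IsIso (f.hom.app d) :=
      (ConcreteCategory.isIso_iff_bijective _).2 (hbij d.unop)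
    have : IsIso f.hom := NatIso.isIso_of_isIso_app _
    have : IsIso ((AdditiveFunctor.forget _ _).map f) := this
    exact isIso_of_reflects_iso f (AdditiveFunctor.forget _ _)
  mem_iSup {I F G} f c g hg := by
    -- The submodule generated by all images. Its quotient map kills every `f i`, hence `g`, so the
    -- Yoneda element of `g` lies in `S`.
    let S (d) : AddSubgroup (G.obj.obj d) := ⨆ i, ((f i).hom.app d).hom.range
    have hS {d d'} (a : d ⟶ d') : S d ≤ (S d').comap (G.obj.map a).hom := by
      refine iSup_le fun i => ?_
      rintro _ ⟨x, rfl⟩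
      refine AddSubgroup.mem_iSup_of_mem i
        ⟨(F i).obj.map a x, ConcreteCategory.congr_hom ((f i).hom.naturality a) x⟩
    have h0 : g ≫ quotientModuleπ G S hS = 0 := hg _ _ fun i => by
      ext d x
      exact (QuotientAddGroup.eq_zero_iff _).2
        (AddSubgroup.mem_iSup_of_mem i ⟨x, rfl⟩)
    have h1 : evalOne g ∈ S (Opposite.op c) :=
      (QuotientAddGroup.eq_zero_iff _).1 (congrArg evalOne h0)
    have h2 := AddSubgroup.mem_map_of_mem ofElement h1
    rw [ofElement_evalOne, AddSubgroup.map_iSup] at h2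
    refine SetLike.le_def.1 (iSup_mono fun i => ?_) h2
    rintro _ ⟨_, ⟨x, rfl⟩, rfl⟩
    exact ⟨ofElement x, ofElement_comp _ _⟩

end RightMod

theorem isModuleLike_regular (S : Type v) [Ring S] :
    IsModuleLike fun _ : PUnit.{v + 1} => ModuleCat.of S S where
  isIso {X Y} f hf := by
    rw [ConcreteCategory.isIso_iff_bijective]
    let e (Z : ModuleCat.{v} S) (z : Z) : ModuleCat.of S S ⟶ Z :=
      ModuleCat.ofHom (LinearMap.toSpanSingleton S Z z)
    have he {Z} (z) : e Z z (1 : S) = z := one_smul _ _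
    have hef (x) : e X x ≫ f = e Y (f x) := by
      ext
      exact congrArg f (he x) |>.trans (he _).symm
    refine ⟨fun x y hxy => ?_, fun y => ?_⟩
    · have : e X x = e X y := (hf ⟨⟩).1 <| by
        dsimp only
        rw [hef, hef, hxy]
      rw [← he x, this, he]
    · obtain ⟨t, ht⟩ := (hf ⟨⟩).2 (e Y y)
      refine ⟨t (1 : S), ?_⟩
      rw [← he y, ← ht]
      rfl
  mem_iSup {I F G} f _ g hg := by
    let N : Submodule S G := ⨆ i, LinearMap.range (f i).hom
    have h0 : g ≫ ModuleCat.ofHom N.mkQ = 0 := hg _ _ fun i => by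
      ext x
      exact (Submodule.Quotient.mk_eq_zero _).2
        (Submodule.mem_iSup_of_mem i ⟨x, rfl⟩)
    have h1 : g (1 : S) ∈ N :=
      (Submodule.Quotient.mk_eq_zero _).1 (ConcreteCategory.congr_hom h0 (1 : S))
    let e (Z : ModuleCat.{v} S) (z : Z) : ModuleCat.of S S ⟶ Z :=
      ModuleCat.ofHom (LinearMap.toSpanSingleton S Z z)
    have hg : g = e G (g (1 : S)) := by
      ext
      exact (one_smul _ _).symm
    rw [hg]
    refine Submodule.iSup_induction (fun i => LinearMap.range (f i).hom)
      (motive := fun z => e G z ∈ _) h1 ?_ ?_ ?_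
    · rintro i _ ⟨x, rfl⟩
      refine AddSubgroup.mem_iSup_of_mem i ⟨e _ x, ?_⟩
      ext
      exact congrArg (f i) (one_smul S x) |>.trans (one_smul S _).symm
    · have : e G 0 = 0 := by ext; exact smul_zero _
      rw [this]
      exact zero_mem _
    · intro x y hx hy
      have : e G (x + y) = e G x + e G y := by ext; exact smul_add _ _ _
      rw [this]
      exact add_mem hx hy

/-- An equivalence preserves binary products, and these determine addition of morphisms; hence the
theorem need not ask for an additive equivalence. -/
theorem additive_of_equivalence {A : Type u} [Category.{v} A] [Abelian A]
    {B : ObjectProperty A} [B.IsClosedUnderFiniteCoproducts]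
    {M : Type*} [Category* M] [Preadditive M] (E : B.FullSubcategory ≌ M) :
    E.functor.Additive := by
  have : HasFiniteBiproducts B.FullSubcategory := HasFiniteBiproducts.of_hasFiniteCoproducts
  exact Functor.additive_of_preserves_binary_products _

end PresentedObjects

/-! ### The main theorem. -/

theorem mainTheorem9 {A : Type u} [Category.{v} A] [Abelian A] [HasColimits A]
    (B : ObjectProperty A) [B.IsClosedUnderIsomorphisms] [B.IsClosedUnderFiniteCoproducts] :
    -- (1) iff (2)
    ((B.ι.IsLeftAdjoint ∧
        ∃ (C : Type v) (_ : SmallCategory C) (_ : Preadditive C),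
          Nonempty (B.FullSubcategory ≌ RightMod C)) ↔
      (B.IsClosedUnderCokernels ∧
        ∃ (𝒰 : Set A) (_ : Small.{v} 𝒰),
          IsSelfSmall 𝒰 ∧ B = Pres 𝒰 ∧ ProjTraceCondition 𝒰)) ∧
    -- in this situation: modules over a ring iff `𝒰` may be chosen with just one object
    ((B.ι.IsLeftAdjoint ∧
        ∃ (C : Type v) (_ : SmallCategory C) (_ : Preadditive C),
          Nonempty (B.FullSubcategory ≌ RightMod C)) →
      ((∃ (R : Type v) (_ : Ring R), Nonempty (B.FullSubcategory ≌ ModuleCat.{v} Rᵐᵒᵖ)) ↔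
        ∃ U : A, IsSelfSmall {U} ∧ B = Pres {U} ∧ ProjTraceCondition {U})) := by
  refine ⟨⟨?_, ?_⟩, ?_⟩
  · rintro ⟨_, C, _, _, ⟨E⟩⟩
    have := additive_of_equivalence E
    have hcok : B.IsClosedUnderColimitsOfShape WalkingParallelPair :=
      isClosedUnderColimitsOfShape_of_isLeftAdjoint_ι B _
    refine ⟨⟨?_⟩, _, small_range fun c => (E.inverse.obj (representable c)).obj,
      exists_of_isModuleLike B (isModuleLike_representable.of_equivalence E) _ rfl⟩
    rintro _ ⟨f, k, hk, h₁, h₂⟩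
    refine B.prop_of_isColimit hk ?_
    rintro (_ | _)
    · exact h₁
    · exact h₂
  · rintro ⟨-, 𝒰, _, hs, rfl, hp⟩
    -- Indexing by `Shrink` puts the objects of the full subcategory on `𝒰` in `Type v`, making it a
    -- small category.
    let u (j : Shrink.{v} 𝒰) : A := ((equivShrink 𝒰).symm j).1
    have hu : 𝒰 = Set.range u := by
      rw [Set.range_comp' Subtype.val (equivShrink 𝒰).symm]
      simp
    have := isEquivalence_restrictedYoneda hu hs hp.projCondition
    exact ⟨isLeftAdjoint_ι_pres hp.projCondition, InducedCategory A u, inferInstance, inferInstance,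
      ⟨(restrictedYoneda u (Pres 𝒰)).asEquivalence⟩⟩
  · rintro ⟨_, -⟩
    refine ⟨?_, ?_⟩
    · rintro ⟨R, _, ⟨E⟩⟩
      have := additive_of_equivalence E
      exact ⟨_, exists_of_isModuleLike B ((isModuleLike_regular Rᵐᵒᵖ).of_equivalence E) _
        Set.range_const.symm⟩
    · rintro ⟨U, hs, rfl, hp⟩
      have := isEquivalence_preadditiveCoyonedaObj hs hp.projCondition
      exact ⟨End U, inferInstance, ⟨((Pres {U}).ι ⋙ preadditiveCoyonedaObj U).asEquivalence⟩⟩
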